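/- **Setting.** Let $\mathcal X$ be a set of examples, $\mathcal Y$ a finite set of labels, and $\Phi$ a set of predicates on $\mathcal X$ (features) that is closed under negation. A representation of size $m\ge 1$ consists of sets $G_1,\dots,G_m$ covering $\mathcal X$, for each $x$ a choice $G(x)$ of one of these sets that contains $x$, labels $\ell(G_i)\in\mathcal Y$, and, for all $i,j$ with $\ell(G_i)\ne\ell(G_j)$, a feature $\phi(G_i,G_j)\in\Phi$ that is true on all of $G_i$ and false on all of $G_j$, with $\phi(G_j,G_i)=\neg\phi(G_i,G_j)$. It has unique labels if $\ell(G_1),\dots,\ell(G_m)$ are pairwise distinct. **Protocol.** A first labeled example $(x_0,y_0)$ is given. In round $t=1,2,\dots$ an example $x_t$ arrives, the learner outputs a prediction $\hat y_t$ and an explanation $\hat x_t$, and the teacher has a label $y_t$ and a feature $\phi_t$; these are revealed to the learner only if $\hat y_t\ne y_t$ (a mistake). The source of the $x_t,y_t,\phi_t$ is an arbitrary adaptive adversary: $x_t$ may depend on everything that happened before round $t$, and $y_t,\phi_t$ also on $\hat y_t,\hat x_t$. Round $t\ge1$ is an exception with respect to a representation if $y_t\ne\ell(G(x_t))$, or if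 $\hat y_t\neq y_t$, $\ell(G(x_t))\ne\ell(G(\hat x_t))$ and $\phi_t\ne\phi(G(x_t),G(\hat x_t))$. The initial example is an exception if $y_0\ne\ell(G(x_0))$. **Algorithm** (parameters $m$, $l\in\mathbb N$, $p\in[0,1]$). Maintain a list $L$ of rules, initially empty; a rule $C[\hat x]$ has a representing example $\hat x$, a label, a conjunction of literals, and an update counter $U(\hat x)$. On $x_t$: * If some rule $C[\hat x]\in L$ is satisfied by $x_t$, predict its label and explain by $\hat x$. If the prediction is wrong: if $\hat x$ satisfies $\neg\phi_t$ and $x_t$ satisfies $\phi_t$, add $\neg\phi_t$ to the conjunction $C[\hat x]$; in any case increase $U(\hat x)$ by $1$, and delete the rule if $U(\hat x)\ge m+l-1$. * If no rule is satisfied by $x_t$, predict $y_0$ and explain by $x_0$. If the prediction is wrong and $L$ has no rule with label $y_t$, draw an independent bit that is $1$ with probability $p$, and if it is $1$ add to $L$ a rule $C[x_t]$ with label $y_t$, empty conjunction and $U(x_t)=0$. If the prediction is wrong and $L$ has a rule $C[\hat x]$ with label $y_t$, remove from its conjunction some literal not satisfied by $x_t$, increase $U(\hat x)$ by $1$, and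 delete the rule if $U(\hat x)\ge m+l-1$. Which satisfied rule is used and which unsatisfied literal is removed is arbitrary (it may depend on the past). **Theorem.** Run the algorithm with $l=m-1$ and with $p=1/(m-1)$ (and $p=1$ if $m=1$). Suppose that there is a representation of size $m$ with unique labels such that, almost surely, at most $k$ exceptions with respect to it occur in the interaction. Then the expected total number of mistakes of the algorithm is at most $2m(m-1)+6k$. -/

import Mathlib

open MeasureTheory ProbabilityTheory
open scoped ENNReal

namespace DFF

/-- A binary feature: a predicate on the domain of examples. -/
abbrev Feature (X : Type*) := X → Bool

/-- The negation of a feature. -/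
def neg {X : Type*} (φ : Feature X) : Feature X := fun x => !φ x

/-- A component representation of size `m` over the feature class `Φ`: components `G i` that cover
the domain, a choice `comp x` of a component containing `x`, a label for each component, and a
choice `disc i j` of a feature discriminating `G i` from `G j` whenever their labels differ
(`disc i j` carries no information when the labels agree). -/
structure Representation (X Y : Type*) (Φ : Set (Feature X)) (m : ℕ) where
  G : Fin m → Set X
  comp : X → Fin m
  mem_comp : ∀ x, x ∈ G (comp x)
  label : Fin m → Y
  disc : Fin m → Fin m → Feature X
  disc_mem : ∀ i j, label i ≠ label j → disc i j ∈ Φ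
  disc_true : ∀ i j, label i ≠ label j → ∀ x ∈ G i, disc i j x = true
  disc_false : ∀ i j, label i ≠ label j → ∀ x ∈ G j, disc i j x = false
  disc_symm : ∀ i j, label i ≠ label j → disc j i = neg (disc i j)

/-- The concept induced by a representation. -/
def Representation.target {X Y : Type*} {Φ : Set (Feature X)} {m : ℕ}
    (R : Representation X Y Φ m) (x : X) : Y := R.label (R.comp x)

/-- Each component has a label of its own. -/
def Representation.UniqueLabels {X Y : Type*} {Φ : Set (Feature X)} {m : ℕ}
    (R : Representation X Y Φ m) : Prop := Function.Injective R.label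

/-- A rule `C[rep]`: its representing example, its conjunction of literals, and the number of
updates applied to it so far. -/
structure Rule (X : Type*) where
  rep : X
  conj : Finset (Feature X)
  updates : ℕ

/-- The example `x` satisfies the conjunction of the rule. -/
def Rule.Sat {X : Type*} (r : Rule X) (x : X) : Prop := ∀ φ ∈ r.conj, φ x = true

/-- The current collection of rules, indexed by their labels. The algorithm creates a rule only if
no rule with that label is present, so there is never more than one rule per label. -/
abbrev Rules (X Y : Type*) := Y → Option (Rule X)

/-- The record of one round: the example, the prediction, the explanation, the label and the feature
of the teacher (used by the learner only if the prediction is incorrect), and the random bit drawn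
by the learner (used only if the learner attempts to create a rule). -/
structure Round (X Y : Type*) where
  x : X
  pred : Y
  expl : X
  y : Y
  feature : Feature X
  coin : Bool

/-- Completed rounds, most recent first. -/
abbrev History (X Y : Type*) := List (Round X Y)

/-- The prediction in a round is incorrect. -/
def Round.IsMistake {X Y : Type*} (ρ : Round X Y) : Prop := ρ.pred ≠ ρ.y

/-- A round is an exception if its label is inconsistent with the representation, or if a
discriminative feature was requested and the feature provided is not the one prescribed by the
representation. (If the components of the example and of the explanation have the same label,
nothing is prescribed, and any feature is accepted.) -/
def Round.IsException {X Y : Type*} {Φ : Set (Feature X)} {m : ℕ}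
    (R : Representation X Y Φ m) (ρ : Round X Y) : Prop :=
  ρ.y ≠ R.target ρ.x ∨
    (ρ.IsMistake ∧ R.label (R.comp ρ.x) ≠ R.label (R.comp ρ.expl) ∧
      ρ.feature ≠ R.disc (R.comp ρ.x) (R.comp ρ.expl))

/-- An adversarial source of labeled examples and feature feedback. The first labeled example is
`(x₀, y₀)`; then the next example may depend on all completed rounds (including the random bits
drawn in them), and its label and the discriminative feature may in addition depend on the
prediction and the explanation of the learner. A fixed stream of examples is the special case in
which `nextExample` and `label` depend only on the number of completed rounds. -/
structure Environment (X Y : Type*) where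
  x₀ : X
  y₀ : Y
  nextExample : History X Y → X
  label : History X Y → Y → X → Y
  feature : History X Y → Y → X → Feature X

/-- The choices that the algorithm leaves open: which satisfied rule is used for the prediction
(identified by its label), and which violated literal is removed from a conjunction. Both may depend
on the past in an arbitrary way. -/
structure Choices (X Y : Type*) where
  rule : History X Y → Rules X Y → X → Y
  rule_spec : ∀ (h : History X Y) (L : Rules X Y) (x : X), (∃ y r, L y = some r ∧ r.Sat x) →
    ∃ r, L (rule h L x) = some r ∧ r.Sat x
  literal : History X Y → Rule X → X → Feature X
  literal_spec : ∀ (h : History X Y) (r : Rule X) (x : X), ¬ r.Sat x →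
    literal h r x ∈ r.conj ∧ literal h r x x = false

open Classical in
/-- The rule used for predicting on `x`, with its label; `none` if no rule is satisfied by `x`. -/
noncomputable def matchedRule {X Y : Type*} (ch : Choices X Y) (h : History X Y) (L : Rules X Y)
    (x : X) : Option (Y × Rule X) :=
  if ∃ y r, L y = some r ∧ r.Sat x then
    (L (ch.rule h L x)).map (fun r => (ch.rule h L x, r))
  else none

/-- The prediction and the explanation on `x`: the label and the representing example of the matched
rule, or `(y₀, x₀)` if there is none. -/
noncomputable def predict {X Y : Type*} (ch : Choices X Y) (x₀ : X) (y₀ : Y) (h : History X Y)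
    (L : Rules X Y) (x : X) : Y × X :=
  match matchedRule ch h L x with
  | some (y, r) => (y, r.rep)
  | none => (y₀, x₀)

/-- Increment the update counter of a rule, and delete the rule if the counter reaches `limit`. -/
def countUpdate {X : Type*} (limit : ℕ) (r : Rule X) : Option (Rule X) :=
  if limit ≤ r.updates + 1 then none else some { r with updates := r.updates + 1 }

open Classical in
/-- The modification of the rules after an incorrect prediction on `x`, given the correct label `y`,
the feature `φ` and the random bit `b`. -/
noncomputable def updateRules {X Y : Type*} (m l : ℕ) (ch : Choices X Y) (h : History X Y)
    (L : Rules X Y) (x : X) (y : Y) (φ : Feature X) (b : Bool) : Rules X Y :=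
  match matchedRule ch h L x with
  | some (z, r) =>
      Function.update L z (countUpdate (m + l - 1)
        (if neg φ r.rep = true ∧ φ x = true then { r with conj := insert (neg φ) r.conj } else r))
  | none =>
      match L y with
      | none => if b = true then Function.update L y (some ⟨x, ∅, 0⟩) else L
      | some r =>
          Function.update L y (countUpdate (m + l - 1)
            { r with conj := r.conj.erase (ch.literal h r x) })

/-- The completed rounds and the current rules. -/
structure State (X Y : Type*) where
  history : History X Y
  rules : Rules X Y

/-- The round played from state `s` with random bit `b`. -/
noncomputable def playRound {X Y : Type*} (env : Environment X Y) (ch : Choices X Y)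
    (s : State X Y) (b : Bool) : Round X Y :=
  let x := env.nextExample s.history
  let a := predict ch env.x₀ env.y₀ s.history s.rules x
  ⟨x, a.1, a.2, env.label s.history a.1 a.2, env.feature s.history a.1 a.2, b⟩

open Classical in
/-- One iteration of the algorithm. -/
noncomputable def step {X Y : Type*} (m l : ℕ) (env : Environment X Y) (ch : Choices X Y)
    (s : State X Y) (b : Bool) : State X Y :=
  let ρ := playRound env ch s b
  { history := ρ :: s.history
    rules :=
      if ρ.IsMistake then updateRules m l ch s.history s.rules ρ.x ρ.y ρ.feature b else s.rules }

/-- The state after `t` rounds when the random bits are `c 0, c 1, …`; initially there are no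
rules. -/
noncomputable def run {X Y : Type*} (m l : ℕ) (env : Environment X Y) (ch : Choices X Y)
    (c : ℕ → Bool) : ℕ → State X Y
  | 0 => ⟨[], fun _ => none⟩
  | t + 1 => step m l env ch (run m l env ch c t) (c t)

/-- The `t`-th round of the run (counting from zero, after the initial example `x₀`). -/
noncomputable def roundAt {X Y : Type*} (m l : ℕ) (env : Environment X Y) (ch : Choices X Y)
    (c : ℕ → Bool) (t : ℕ) : Round X Y :=
  playRound env ch (run m l env ch c t) (c t)

open Classical in
/-- The total number of mistakes of the run. -/
noncomputable def numMistakes {X Y : Type*} (m l : ℕ) (env : Environment X Y) (ch : Choices X Y)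
    (c : ℕ → Bool) : ℝ≥0∞ :=
  ∑' t, if (roundAt m l env ch c t).IsMistake then 1 else 0

open Classical in
/-- The total number of exceptions of the run with respect to a representation, including the
initial example `x₀` if its label is inconsistent with the representation. -/
noncomputable def numExceptions {X Y : Type*} {Φ : Set (Feature X)} {m' : ℕ}
    (R : Representation X Y Φ m') (m l : ℕ) (env : Environment X Y) (ch : Choices X Y)
    (c : ℕ → Bool) : ℝ≥0∞ :=
  (if env.y₀ ≠ R.target env.x₀ then 1 else 0) +
    ∑' t, if (roundAt m l env ch c t).IsException R then 1 else 0

end DFF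

/-! A potential assigned to the labels drops in conditional expectation by at least 1 at each
mistake, except that an exception may cost 6 instead. Call a rule good if its representing example
truly has the rule's label. The correct literals for its component number at most `m - 1`, and the
defect `d` measures the distance of its conjunction from them. A mistake without exception lowers
`d`: a matched rule gains a correct literal, an unmatched one loses an incorrect literal. The
counter `u` rises by 1 at the same time, so `u + d`, initially `m - 1`, does not grow. An exception
raises it by at most 2. Deletion at `u = 2 * (m - 1)` therefore needs a large excess of `u + d` over
`m - 1`; the potential `d` plus twice this excess pays for restoring the vacant value `2 * (m - 1)`.
A bad rule is created only in an exception. It carries the vacant potential plus its remaining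
updates, so its mistakes and its deletion are prepaid. Creating a good rule lowers the potential
from `2 * (m - 1)` to `m - 1`, with probability `1 / (m - 1)`: an expected gain of 1. Creating a bad
one costs at most 2 in expectation, for the same reason. `mistake_add_potential_step_le` combines
these cases. Each bit is independent of the earlier ones, so the inequality can be integrated and
telescoped from an initial potential of at most `2 * m * (m - 1)`, up to the initial exception. -/

namespace DFF

/-! ### Defect of a conjunction and potential of a list of rules. -/

section Potential

variable {X Y : Type*} {Φ : Set (Feature X)} {m : ℕ}

open Classical in
/-- The features that discriminate the component `i` from the components with other labels. -/
noncomputable def Representation.literals (R : Representation X Y Φ m) (i : Fin m) :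
    Finset (Feature X) :=
  (Finset.univ.filter fun j => R.label i ≠ R.label j).image (R.disc i)

theorem Representation.card_literals_le (R : Representation X Y Φ m) (i : Fin m) :
    (R.literals i).card ≤ m - 1 := by
  classical
  refine Finset.card_image_le.trans ?_
  have h : (Finset.univ.filter fun j => R.label i ≠ R.label j) ⊆ Finset.univ.erase i := by
    intro j hj
    rw [Finset.mem_filter] at hj
    refine Finset.mem_erase.2 ⟨?_, Finset.mem_univ j⟩
    rintro rfl
    exact hj.2 rfl
  simpa using Finset.card_le_card h

theorem Representation.disc_mem_literals (R : Representation X Y Φ m) {i j : Fin m}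
    (h : R.label i ≠ R.label j) : R.disc i j ∈ R.literals i := by
  classical
  exact Finset.mem_image_of_mem _ (Finset.mem_filter.2 ⟨Finset.mem_univ j, h⟩)

theorem Representation.eq_true_of_mem_literals (R : Representation X Y Φ m) {φ : Feature X} {x : X}
    (h : φ ∈ R.literals (R.comp x)) : φ x = true := by
  classical
  obtain ⟨j, hj, rfl⟩ := Finset.mem_image.1 h
  exact R.disc_true _ _ (Finset.mem_filter.1 hj).2 x (R.mem_comp x)

open Classical in
/-- The number of literals missing from a conjunction (out of `m - 1`) plus the number of literals
that it should not contain, relative to a set `S` of correct literals. -/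
noncomputable def defect (m : ℕ) (S C : Finset (Feature X)) : ℕ :=
  (m - 1 - (C ∩ S).card) + (C \ S).card

theorem defect_empty (S : Finset (Feature X)) : defect m S ∅ = m - 1 := by
  simp [defect]

-- The bound on `S.card` keeps the truncated subtraction in `defect` from hiding the gain.
open Classical in
theorem defect_insert_lt {S C : Finset (Feature X)} (hS : S.card ≤ m - 1) {φ : Feature X}
    (hφ : φ ∈ S) (hC : φ ∉ C) : defect m S (insert φ C) + 1 ≤ defect m S C := by
  have h1 : (insert φ C ∩ S).card = (C ∩ S).card + 1 := by
    rw [Finset.insert_inter_of_mem hφ, Finset.card_insert_of_notMem]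
    exact fun h => hC (Finset.mem_inter.1 h).1
  have h2 : (insert φ C ∩ S).card ≤ S.card := Finset.card_le_card Finset.inter_subset_right
  have h3 : insert φ C \ S = C \ S := Finset.insert_sdiff_of_mem _ hφ
  unfold defect
  rw [h3]
  omega

open Classical in
theorem defect_insert_le (S C : Finset (Feature X)) (φ : Feature X) :
    defect m S (insert φ C) ≤ defect m S C + 1 := by
  have h1 : (C ∩ S).card ≤ (insert φ C ∩ S).card :=
    Finset.card_le_card (Finset.inter_subset_inter_right (Finset.subset_insert _ _))
  have h2 : (insert φ C \ S).card ≤ (C \ S).card + 1 := by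
    refine (Finset.card_le_card ?_).trans (Finset.card_insert_le φ (C \ S))
    intro ψ
    simp only [Finset.mem_sdiff, Finset.mem_insert]
    tauto
  unfold defect
  omega

open Classical in
theorem defect_erase_lt {S C : Finset (Feature X)} {φ : Feature X}
    (hφ : φ ∉ S) (hC : φ ∈ C) : defect m S (C.erase φ) + 1 ≤ defect m S C := by
  have h1 : C.erase φ ∩ S = C ∩ S := by
    ext ψ
    simp only [Finset.mem_inter, Finset.mem_erase]
    constructor
    · exact fun h => ⟨h.1.2, h.2⟩
    · exact fun h => ⟨⟨fun e => hφ (e ▸ h.2), h.1⟩, h.2⟩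
  have h2 : (C.erase φ \ S).card + 1 = (C \ S).card := by
    rw [Finset.erase_sdiff_comm]
    exact Finset.card_erase_add_one (Finset.mem_sdiff.2 ⟨hC, hφ⟩)
  unfold defect
  rw [h1]
  omega

open Classical in
theorem defect_erase_le (S C : Finset (Feature X)) (φ : Feature X) :
    defect m S (C.erase φ) ≤ defect m S C + 1 := by
  have h1 : (C ∩ S).card ≤ (C.erase φ ∩ S).card + 1 := by
    rw [Finset.erase_inter]
    exact Nat.sub_le_iff_le_add.1 Finset.pred_card_le_card_erase
  have h2 : (C.erase φ \ S).card ≤ (C \ S).card :=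
    Finset.card_le_card (Finset.sdiff_subset_sdiff (Finset.erase_subset _ _) le_rfl)
  unfold defect
  omega

open Classical in
/-- The potential of a label without a rule. -/
noncomputable def vacantPotential (R : Representation X Y Φ m) (y₀ y : Y) : ℕ :=
  if y ∈ Set.range R.label ∧ y ≠ y₀ then max (2 * (m - 1)) 1 else 0

open Classical in
/-- The potential of a rule with label `y`. -/
noncomputable def rulePotential (R : Representation X Y Φ m) (y₀ y : Y) (r : Rule X) : ℕ :=
  if R.target r.rep = y then
    defect m (R.literals (R.comp r.rep)) r.conj +
      2 * (r.updates + defect m (R.literals (R.comp r.rep)) r.conj - (m - 1))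
  else vacantPotential R y₀ y + max (2 * (m - 1) - r.updates) 1

/-- The potential of a label. -/
noncomputable def labelPotential (R : Representation X Y Φ m) (y₀ y : Y) : Option (Rule X) → ℕ
  | none => vacantPotential R y₀ y
  | some r => rulePotential R y₀ y r

/-- The potential of a collection of rules. -/
noncomputable def potential [Fintype Y] (R : Representation X Y Φ m) (y₀ : Y) (L : Rules X Y) : ℕ :=
  ∑ y, labelPotential R y₀ y (L y)

theorem vacantPotential_le (R : Representation X Y Φ m) (y₀ y : Y) :
    vacantPotential R y₀ y ≤ max (2 * (m - 1)) 1 := by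
  unfold vacantPotential
  split_ifs <;> simp

open Classical in
theorem potential_update [Fintype Y] (R : Representation X Y Φ m) (y₀ : Y) (L : Rules X Y) (y : Y)
    (o : Option (Rule X)) :
    potential R y₀ (Function.update L y o) + labelPotential R y₀ y (L y) =
      potential R y₀ L + labelPotential R y₀ y o := by
  unfold potential
  rw [← Finset.add_sum_erase _ _ (Finset.mem_univ y),
    ← Finset.add_sum_erase _ (fun z => labelPotential R y₀ z (L z)) (Finset.mem_univ y),
    Function.update_self]
  have h : ∑ z ∈ Finset.univ.erase y, labelPotential R y₀ z (Function.update L y o z) =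
      ∑ z ∈ Finset.univ.erase y, labelPotential R y₀ z (L z) :=
    Finset.sum_congr rfl fun z hz => by rw [Function.update_of_ne (Finset.ne_of_mem_erase hz)]
  rw [h]
  ring

/-- Progress for an update without exception. Only a good rule has to improve its conjunction; a bad
one pays with its counter. -/
theorem labelPotential_countUpdate_lt (R : Representation X Y Φ m) (y₀ y : Y) {n : ℕ}
    (hn : n = 2 * (m - 1)) (r : Rule X) (C : Finset (Feature X))
    (h : R.target r.rep = y → defect m (R.literals (R.comp r.rep)) C + 1 ≤
      defect m (R.literals (R.comp r.rep)) r.conj) :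
    labelPotential R y₀ y (countUpdate n { r with conj := C }) + 1 ≤ rulePotential R y₀ y r := by
  have hv := vacantPotential_le R y₀ y
  unfold countUpdate
  split_ifs with hu
  -- Deletion: a good rule has `d ≥ 1` and `u ≥ 2 * (m - 1) - 1`, hence potential at least `2 * (m -
  -- 1) + 1`. A bad rule keeps the vacant potential and gives up its reserve of at least 1.
  · by_cases hy : R.target r.rep = y
    · have := h hy
      simp only [labelPotential, rulePotential, hy, if_true] at *
      omega
    · simp only [labelPotential, rulePotential, hy, if_false] at *
      omega
  · by_cases hy : R.target r.rep = y
    · have := h hy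
      simp only [labelPotential, rulePotential, hy, if_true] at *
      omega
    · simp only [labelPotential, rulePotential, hy, if_false] at *
      omega

/-- Source of the constant 6: `d` and `u` each rise by at most 1, so the potential of a surviving
good rule rises by at most `1 + 2 * 2`, and the mistake itself counts 1. -/
theorem labelPotential_countUpdate_le (R : Representation X Y Φ m) (y₀ y : Y) {n : ℕ}
    (hn : n = 2 * (m - 1)) (r : Rule X) (C : Finset (Feature X))
    (h : defect m (R.literals (R.comp r.rep)) C ≤
      defect m (R.literals (R.comp r.rep)) r.conj + 1) :
    labelPotential R y₀ y (countUpdate n { r with conj := C }) + 1 ≤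
      rulePotential R y₀ y r + 6 := by
  have hv := vacantPotential_le R y₀ y
  unfold countUpdate
  split_ifs with hu <;> by_cases hy : R.target r.rep = y <;>
    simp only [labelPotential, rulePotential, hy, if_true, if_false] at * <;> omega

theorem rulePotential_new_of_target_eq (R : Representation X Y Φ m) (y₀ : Y) {x : X} {y : Y}
    (h : R.target x = y) : rulePotential R y₀ y ⟨x, ∅, 0⟩ = m - 1 := by
  simp [rulePotential, h, defect_empty]

theorem rulePotential_new_of_target_ne (R : Representation X Y Φ m) (y₀ : Y) {x : X} {y : Y}
    (h : R.target x ≠ y) :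
    rulePotential R y₀ y ⟨x, ∅, 0⟩ = vacantPotential R y₀ y + max (2 * (m - 1)) 1 := by
  simp [rulePotential, h]

open Classical in
theorem potential_empty_le [Fintype Y] (R : Representation X Y Φ m) (x₀ : X) (y₀ : Y) :
    potential R y₀ (fun _ => none) ≤
      2 * m * (m - 1) + 6 * (if y₀ ≠ R.target x₀ then 1 else 0) := by
  have hpos : 0 < m := Nat.lt_of_le_of_lt (Nat.zero_le _) (R.comp x₀).isLt
  have h1 : potential R y₀ (fun _ => none) =
      ((Finset.univ.image R.label).erase y₀).card * max (2 * (m - 1)) 1 := by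
    simp only [potential, labelPotential, vacantPotential]
    rw [← Finset.sum_filter, Finset.sum_const, smul_eq_mul]
    congr 2
    ext y
    simp [and_comm]
  have h2 : ((Finset.univ.image R.label).erase y₀).card ≤ m :=
    (Finset.card_le_card (Finset.erase_subset _ _)).trans
      (Finset.card_image_le.trans (by simp))
  rw [h1]
  rcases Nat.lt_or_ge 1 m with hm | hm
  · rw [max_eq_left (by omega)]
    calc _ ≤ m * (2 * (m - 1)) := Nat.mul_le_mul_right _ h2
      _ = 2 * m * (m - 1) := by ring
      _ ≤ _ := Nat.le_add_right _ _
  -- Here the `max` with 1 matters: the single label has vacant potential 1 unless it equals `y₀`.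
  -- If it differs, the initial example is an exception and pays.
  · obtain rfl : m = 1 := by omega
    split_ifs with h
    · simp only [Nat.sub_self, mul_zero, Nat.max_eq_right (Nat.zero_le 1), mul_one]
      omega
    · have h3 : ((Finset.univ.image R.label).erase y₀) = ∅ := by
        ext y
        simp only [Finset.mem_erase, Finset.mem_image, Finset.mem_univ, true_and,
          Finset.notMem_empty, iff_false, not_and, not_exists]
        rintro hy i rfl
        refine hy ?_
        rw [not_not.1 h, Representation.target, Subsingleton.elim i]
      rw [h3]
      simp

theorem matchedRule_eq_some {ch : Choices X Y} {h : History X Y} {L : Rules X Y} {x : X} {y : Y}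
    {r : Rule X} (hr : matchedRule ch h L x = some (y, r)) : L y = some r ∧ r.Sat x := by
  unfold matchedRule at hr
  split_ifs at hr with hex
  obtain ⟨r', h1, h2⟩ := ch.rule_spec h L x hex
  rw [h1] at hr
  simp only [Option.map_some, Option.some.injEq, Prod.mk.injEq] at hr
  obtain ⟨rfl, rfl⟩ := hr
  exact ⟨h1, h2⟩

theorem not_sat_of_matchedRule_eq_none {ch : Choices X Y} {h : History X Y} {L : Rules X Y} {x : X}
    (hr : matchedRule ch h L x = none) {y : Y} {r : Rule X} (hy : L y = some r) : ¬ r.Sat x := by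
  intro hs
  unfold matchedRule at hr
  have hex : ∃ y r, L y = some r ∧ r.Sat x := ⟨y, r, hy, hs⟩
  rw [if_pos hex] at hr
  obtain ⟨r', h1, -⟩ := ch.rule_spec h L x hex
  rw [h1] at hr
  simp at hr

end Potential

end DFF

namespace DFF

/-! ### Expected change of the potential in one round. -/

section Progress

variable {X Y : Type*} {Φ : Set (Feature X)} {m : ℕ}

theorem potential_updateRules_of_matched [Fintype Y] (R : Representation X Y Φ m) (y₀ : Y)
    (ch : Choices X Y) (h : History X Y) (L : Rules X Y) {x : X} {y z : Y} {φ : Feature X}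
    (b : Bool) {r : Rule X} {c : ℕ} (hr : matchedRule ch h L x = some (z, r)) (hz : z ≠ y)
    (hc : ¬ (y = R.target x ∧ (R.label (R.comp x) ≠ R.label (R.comp r.rep) →
      φ = R.disc (R.comp x) (R.comp r.rep))) → c = 6) :
    potential R y₀ (updateRules m (m - 1) ch h L x y φ b) + 1 ≤ potential R y₀ L + c := by
  classical
  obtain ⟨hL, hs⟩ := matchedRule_eq_some hr
  have hpos : 0 < m := Nat.lt_of_le_of_lt (Nat.zero_le _) (R.comp x).isLt
  have hn : m + (m - 1) - 1 = 2 * (m - 1) := by omega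
  simp only [updateRules, hr]
  set r' : Rule X :=
    if neg φ r.rep = true ∧ φ x = true then { r with conj := insert (neg φ) r.conj } else r
    with hr'
  have h1 := potential_update R y₀ L z (countUpdate (m + (m - 1) - 1) r')
  rw [hL] at h1
  have hform : r' = { r with conj := r'.conj } := by
    rw [hr']
    split_ifs <;> rfl
  have h2 : labelPotential R y₀ z (countUpdate (m + (m - 1) - 1) r') + 1 ≤
      rulePotential R y₀ z r + c := by
    rw [hform]
    by_cases hE : y = R.target x ∧ (R.label (R.comp x) ≠ R.label (R.comp r.rep) →
      φ = R.disc (R.comp x) (R.comp r.rep))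
    · refine le_trans (labelPotential_countUpdate_lt R y₀ z hn r _ fun hg => ?_)
        (Nat.le_add_right _ _)
      -- For a good rule the wrong prediction is the true label of its representing example, so the
      -- teacher's feature is the prescribed one and its negation is a correct literal.
      have hne : R.label (R.comp x) ≠ R.label (R.comp r.rep) := by
        intro he
        exact hz (hg.symm.trans (he.symm.trans hE.1.symm))
      have hφ := hE.2 hne
      have hneg : neg φ = R.disc (R.comp r.rep) (R.comp x) := by
        rw [hφ, R.disc_symm _ _ hne]
      have ht1 : neg φ r.rep = true := by
        rw [hneg]
        exact R.disc_true _ _ hne.symm _ (R.mem_comp _)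
      have ht2 : φ x = true := by
        rw [hφ]
        exact R.disc_true _ _ hne _ (R.mem_comp _)
      have hconj : r'.conj = insert (neg φ) r.conj := by
        rw [hr', if_pos ⟨ht1, ht2⟩]
      rw [hconj]
      refine defect_insert_lt (R.card_literals_le _) ?_ ?_
      · rw [hneg]
        exact R.disc_mem_literals hne.symm
      -- The literal is new, since `x` satisfies the conjunction but falsifies `neg φ`.
      · intro hmem
        have := hs _ hmem
        simp [neg, ht2] at this
    · rw [hc hE]
      refine labelPotential_countUpdate_le R y₀ z hn r _ ?_
      rw [hr']
      split_ifs
      · exact defect_insert_le _ _ _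
      · exact Nat.le_succ _
  simp only [labelPotential] at h1 h2
  omega

theorem potential_updateRules_of_unmatched [Fintype Y] (R : Representation X Y Φ m)
    (hR : R.UniqueLabels) (y₀ : Y)
    (ch : Choices X Y) (h : History X Y) (L : Rules X Y) {x : X} {y : Y} (φ : Feature X)
    (b : Bool) {r : Rule X} {c : ℕ} (hr : matchedRule ch h L x = none) (hL : L y = some r)
    (hc : y ≠ R.target x → c = 6) :
    potential R y₀ (updateRules m (m - 1) ch h L x y φ b) + 1 ≤ potential R y₀ L + c := by
  classical
  have hs := not_sat_of_matchedRule_eq_none hr hL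
  obtain ⟨hl1, hl2⟩ := ch.literal_spec h r x hs
  have hpos : 0 < m := Nat.lt_of_le_of_lt (Nat.zero_le _) (R.comp x).isLt
  have hn : m + (m - 1) - 1 = 2 * (m - 1) := by omega
  simp only [updateRules, hr, hL]
  have h1 := potential_update R y₀ L y (countUpdate (m + (m - 1) - 1)
    { r with conj := r.conj.erase (ch.literal h r x) })
  rw [hL] at h1
  have h2 : labelPotential R y₀ y (countUpdate (m + (m - 1) - 1)
      { r with conj := r.conj.erase (ch.literal h r x) }) + 1 ≤ rulePotential R y₀ y r + c := by
    by_cases hE : y = R.target x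
    · refine le_trans (labelPotential_countUpdate_lt R y₀ y hn r _ fun hg => ?_)
        (Nat.le_add_right _ _)
      refine defect_erase_lt (fun hmem => ?_) hl1
      -- Unique labels put `x` in the rule's own component, where all correct literals hold; the
      -- violated literal is thus incorrect.
      have hcomp : R.comp r.rep = R.comp x := hR (hg.trans hE)
      rw [hcomp] at hmem
      have := R.eq_true_of_mem_literals hmem
      simp [hl2] at this
    · rw [hc hE]
      exact labelPotential_countUpdate_le R y₀ y hn r _ (defect_erase_le _ _ _)
  simp only [labelPotential] at h1 h2
  omega

/-- The probability of creating a rule. -/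
noncomputable def creationProb (m : ℕ) : ℝ := if m = 1 then 1 else 1 / ((m : ℝ) - 1)

theorem creationProb_nonneg {m : ℕ} (hm : 0 < m) : 0 ≤ creationProb m := by
  unfold creationProb
  have : (1 : ℝ) ≤ m := by exact_mod_cast hm
  split_ifs
  · exact zero_le_one
  · exact div_nonneg zero_le_one (by linarith)

theorem creationProb_le_one {m : ℕ} (hm : 0 < m) : creationProb m ≤ 1 := by
  unfold creationProb
  split_ifs with h
  · exact le_rfl
  · have : (2 : ℝ) ≤ m := by exact_mod_cast (show 2 ≤ m by omega)
    rw [div_le_one (by linarith)]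
    linarith

theorem potential_updateRules_of_vacant [Fintype Y] (R : Representation X Y Φ m) {y₀ : Y}
    (ch : Choices X Y) (h : History X Y) (L : Rules X Y) {x : X} {y : Y} (φ : Feature X)
    {c : ℕ} (hr : matchedRule ch h L x = none) (hL : L y = none) (hy : y₀ ≠ y)
    (hc : y ≠ R.target x → c = 6) :
    1 + creationProb m * potential R y₀ (updateRules m (m - 1) ch h L x y φ true) +
      (1 - creationProb m) * potential R y₀ (updateRules m (m - 1) ch h L x y φ false) ≤
        (potential R y₀ L + c : ℝ) := by
  classical
  have hpos : 0 < m := Nat.lt_of_le_of_lt (Nat.zero_le _) (R.comp x).isLt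
  simp only [updateRules, hr, hL, if_true, Bool.false_eq_true, if_false]
  have h1 := potential_update R y₀ L y (some ⟨x, ∅, 0⟩)
  rw [hL] at h1
  simp only [labelPotential] at h1
  have h1' : (potential R y₀ (Function.update L y (some ⟨x, ∅, 0⟩)) : ℝ) +
      vacantPotential R y₀ y = potential R y₀ L + rulePotential R y₀ y ⟨x, ∅, 0⟩ := by
    exact_mod_cast h1
  have hp0 := creationProb_nonneg hpos
  -- The two sides of the choice of probability: a bad rule costs at most 2 in expectation, and a
  -- good one gains enough to pay for the mistake.
  have hd : creationProb m * ((max (2 * (m - 1)) 1 : ℕ) : ℝ) ≤ 2 ∧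
      1 + creationProb m * ((m - 1 : ℕ) - (max (2 * (m - 1)) 1 : ℕ) : ℝ) ≤ 0 := by
    unfold creationProb
    split_ifs with hm
    · subst hm
      norm_num
    · have h2 : 2 ≤ m := by omega
      have h2' : (2 : ℝ) ≤ m := by exact_mod_cast h2
      have h3 : (m : ℝ) - 1 ≠ 0 := by linarith
      rw [max_eq_left (by omega)]
      push_cast [hpos]
      constructor <;> field_simp <;> linarith
  have hc0 : (0 : ℝ) ≤ c := Nat.cast_nonneg c
  by_cases hE : R.target x = y
  · have hv : vacantPotential R y₀ y = max (2 * (m - 1)) 1 :=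
      if_pos ⟨⟨_, hE⟩, hy.symm⟩
    rw [rulePotential_new_of_target_eq R y₀ hE, hv] at h1'
    rw [eq_sub_of_add_eq h1']
    linarith [hd.2]
  · rw [rulePotential_new_of_target_ne R y₀ hE] at h1'
    push_cast at h1' hd
    rw [eq_sub_of_add_eq h1', hc (Ne.symm hE)]
    push_cast
    linarith [hd.1]

open Classical in
theorem mistake_add_potential_step_le [Fintype Y] (R : Representation X Y Φ m)
    (hR : R.UniqueLabels) (env : Environment X Y) (ch : Choices X Y) (s : State X Y) :
    ((if (playRound env ch s true).IsMistake then 1 else 0 : ℕ) : ℝ) +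
      creationProb m * potential R env.y₀ (step m (m - 1) env ch s true).rules +
      (1 - creationProb m) * potential R env.y₀ (step m (m - 1) env ch s false).rules ≤
    potential R env.y₀ s.rules +
      (6 * (if (playRound env ch s true).IsException R then 1 else 0) : ℕ) := by
  have hpos : 0 < m := Nat.lt_of_le_of_lt (Nat.zero_le _) (R.comp env.x₀).isLt
  have hp0 := creationProb_nonneg hpos
  have hp1 := creationProb_le_one hpos
  -- The bit is recorded in the round but influences neither prediction nor label.
  have hfalse : (playRound env ch s false).IsMistake ↔ (playRound env ch s true).IsMistake :=
    Iff.rfl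
  generalize hc : (6 * (if (playRound env ch s true).IsException R then 1 else 0) : ℕ) = c
  by_cases hM : (playRound env ch s true).IsMistake
  swap
  · have hM' := mt hfalse.1 hM
    simp only [step, hM, hM', if_false]
    push_cast
    have : (0 : ℝ) ≤ c := Nat.cast_nonneg c
    linarith
  have hM' := hfalse.2 hM
  simp only [step, hM, hM', if_true]
  have hE : (playRound env ch s true).IsException R → c = 6 := fun h => by rw [← hc, if_pos h]
  -- When a rule is updated, the bound holds for both values of the bit and hence for their average.
  have combine : ∀ V V₁ V₂ : ℕ, V₁ + 1 ≤ V + c → V₂ + 1 ≤ V + c →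
      ((1 : ℕ) : ℝ) + creationProb m * V₁ + (1 - creationProb m) * V₂ ≤ V + c := by
    intro V V₁ V₂ h1 h2
    have h1' : (V₁ : ℝ) + 1 ≤ V + c := by exact_mod_cast h1
    have h2' : (V₂ : ℝ) + 1 ≤ V + c := by exact_mod_cast h2
    push_cast
    nlinarith [mul_le_mul_of_nonneg_left h1' hp0,
      mul_le_mul_of_nonneg_left h2' (sub_nonneg.2 hp1)]
  set x := env.nextExample s.history with hx
  rcases hmr : matchedRule ch s.history s.rules x with _ | ⟨z, r⟩
  · have hpred : predict ch env.x₀ env.y₀ s.history s.rules x = (env.y₀, env.x₀) := by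
      simp only [predict, hmr]
    have hne : env.y₀ ≠ (playRound env ch s true).y := by
      have := hM
      simp only [Round.IsMistake] at this
      rwa [show (playRound env ch s true).pred = env.y₀ from congrArg Prod.fst hpred] at this
    have hc' : (playRound env ch s true).y ≠ R.target x → c = 6 := fun h => hE (Or.inl h)
    rcases hL : s.rules (playRound env ch s true).y with _ | r
    · rw [Nat.cast_one]
      exact potential_updateRules_of_vacant R ch s.history s.rules _ hmr hL hne hc'
    · exact combine _ _ _
        (potential_updateRules_of_unmatched R hR env.y₀ ch s.history s.rules _ true hmr hL hc')
        (potential_updateRules_of_unmatched R hR env.y₀ ch s.history s.rules _ false hmr hL hc')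
  · have hpred : predict ch env.x₀ env.y₀ s.history s.rules x = (z, r.rep) := by
      simp only [predict, hmr]
    have hexpl : (playRound env ch s true).expl = r.rep := congrArg Prod.snd hpred
    have hne : z ≠ (playRound env ch s true).y := by
      have := hM
      simp only [Round.IsMistake] at this
      rwa [show (playRound env ch s true).pred = z from congrArg Prod.fst hpred] at this
    have hc' : ¬ ((playRound env ch s true).y = R.target x ∧
        (R.label (R.comp x) ≠ R.label (R.comp r.rep) →
          (playRound env ch s true).feature = R.disc (R.comp x) (R.comp r.rep))) → c = 6 := by
      intro h
      refine hE ?_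
      rw [not_and_or] at h
      rcases h with h | h
      · exact Or.inl h
      · rw [Classical.not_imp] at h
        refine Or.inr ⟨hM, ?_⟩
        rw [hexpl]
        exact h
    exact combine _ _ _
      (potential_updateRules_of_matched R env.y₀ ch s.history s.rules true hmr hne hc')
      (potential_updateRules_of_matched R env.y₀ ch s.history s.rules false hmr hne hc')

end Progress

end DFF

namespace DFF

/-! ### Independence of the bits and telescoping of expectations. -/

section Expectation

theorem run_congr {X Y : Type*} (m l : ℕ) (env : Environment X Y) (ch : Choices X Y)
    {c c' : ℕ → Bool} {t : ℕ} (h : ∀ i < t, c i = c' i) :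
    run m l env ch c t = run m l env ch c' t := by
  induction t with
  | zero => rfl
  | succ t ih =>
    simp only [run]
    rw [ih fun i hi => h i (hi.trans (Nat.lt_succ_self t)), h t (Nat.lt_succ_self t)]

/-- Extend a finite sequence of bits by `false`. -/
def extendBits {t : ℕ} (g : Finset.range t → Bool) (i : ℕ) : Bool :=
  if h : i ∈ Finset.range t then g ⟨i, h⟩ else false

/-- Factoring through finitely many bits gives a countable domain, on which every function is
measurable; no measurable structure on `X` or `Y` is needed. -/
theorem comp_bits_eq {Ω : Type*} {B : ℕ → Ω → Bool} {α : Type*} {t : ℕ} {F : (ℕ → Bool) → α}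
    (hF : ∀ c c' : ℕ → Bool, (∀ i < t, c i = c' i) → F c = F c') :
    (fun ω => F fun i => B i ω) =
      (F ∘ extendBits) ∘ fun ω (i : Finset.range t) => B i ω := by
  ext ω
  refine hF _ _ fun i hi => ?_
  simp [extendBits, hi]

variable {Ω : Type*} [MeasurableSpace Ω] {B : ℕ → Ω → Bool}

theorem measurable_of_bits (hB : ∀ t, Measurable (B t)) {t : ℕ} {F : (ℕ → Bool) → ℝ≥0∞}
    (hF : ∀ c c' : ℕ → Bool, (∀ i < t, c i = c' i) → F c = F c') :
    Measurable fun ω => F fun i => B i ω := by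
  rw [comp_bits_eq hF]
  exact (measurable_of_countable _).comp (measurable_pi_lambda _ fun i => hB i)

/-- Replaces conditioning on the past: `F b` sees only bits before `t`, so it is independent of the
event that bit `t` equals `b`. -/
theorem lintegral_next_bit {μ : Measure Ω} [IsProbabilityMeasure μ]
    (hB : ∀ t, Measurable (B t)) (hindep : iIndepFun B μ) {p : ℝ} (hp0 : 0 ≤ p) {t : ℕ}
    (hp : μ {ω | B t ω = true} = ENNReal.ofReal p)
    {F : Bool → (ℕ → Bool) → ℝ≥0∞}
    (hF : ∀ b, ∀ c c' : ℕ → Bool, (∀ i < t, c i = c' i) → F b c = F b c') :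
    ∫⁻ ω, F (B t ω) (fun i => B i ω) ∂μ =
      ENNReal.ofReal p * ∫⁻ ω, F true (fun i => B i ω) ∂μ +
        ENNReal.ofReal (1 - p) * ∫⁻ ω, F false (fun i => B i ω) ∂μ := by
  have hm : ∀ b, MeasurableSet {ω | B t ω = b} := fun b => hB t (measurableSet_singleton b)
  have hp' : μ {ω | B t ω = false} = ENNReal.ofReal (1 - p) := by
    have : {ω | B t ω = false} = {ω | B t ω = true}ᶜ := by
      ext ω
      simp
    rw [this, prob_compl_eq_one_sub (hm true), hp, ENNReal.ofReal_sub _ hp0, ENNReal.ofReal_one]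
  have key : ∀ b, ∫⁻ ω, F b (fun i => B i ω) * ({ω | B t ω = b}.indicator 1 ω) ∂μ =
      (∫⁻ ω, F b (fun i => B i ω) ∂μ) * μ {ω | B t ω = b} := by
    intro b
    rw [← lintegral_indicator_one (hm b)]
    have hind := hindep.indepFun_finset (Finset.range t) {t} (by simp) hB
    have hind2 := hind.comp (φ := F b ∘ extendBits)
      (ψ := fun g : ({t} : Finset ℕ) → Bool =>
        if g ⟨t, Finset.mem_singleton_self t⟩ = b then (1 : ℝ≥0∞) else 0)
      (measurable_of_countable _) (measurable_of_countable _)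
    have he : ((fun g : ({t} : Finset ℕ) → Bool =>
        if g ⟨t, Finset.mem_singleton_self t⟩ = b then (1 : ℝ≥0∞) else 0) ∘
          fun ω (i : ({t} : Finset ℕ)) => B i ω) = {ω | B t ω = b}.indicator 1 := by
      ext ω
      simp [Set.indicator_apply]
    rw [he, ← comp_bits_eq (hF b)] at hind2
    exact lintegral_mul_eq_lintegral_mul_lintegral_of_indepFun (measurable_of_bits hB (hF b))
      (measurable_one.indicator (hm b)) hind2
  have hsplit : ∀ ω, F (B t ω) (fun i => B i ω) =
      F true (fun i => B i ω) * ({ω | B t ω = true}.indicator 1 ω) +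
        F false (fun i => B i ω) * ({ω | B t ω = false}.indicator 1 ω) := by
    intro ω
    cases h : B t ω <;> simp [h]
  simp_rw [hsplit]
  have hmeas : Measurable fun ω =>
      F true (fun i => B i ω) * ({ω | B t ω = true}.indicator (1 : Ω → ℝ≥0∞) ω) :=
    (measurable_of_bits hB (hF true)).mul (measurable_one.indicator (hm true))
  rw [lintegral_add_left hmeas, key, key, hp, hp', mul_comm, mul_comm (ENNReal.ofReal (1 - p))]

variable {X Y : Type*} {Φ : Set (Feature X)} {m : ℕ}

open Classical in
theorem measurable_indicator_round (hB : ∀ t, Measurable (B t)) (l : ℕ) (env : Environment X Y)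
    (ch : Choices X Y) (P : Round X Y → Prop) (t : ℕ) :
    Measurable fun ω =>
      if P (roundAt m l env ch (fun i => B i ω) t) then (1 : ℝ≥0∞) else 0 := by
  refine measurable_of_bits hB (t := t + 1)
    (F := fun c => if P (roundAt m l env ch c t) then (1 : ℝ≥0∞) else 0) fun c c' h => ?_
  have hround : roundAt m l env ch c t = roundAt m l env ch c' t := by
    unfold roundAt
    rw [run_congr m l env ch fun i hi => h i (hi.trans (Nat.lt_succ_self t)),
      h t (Nat.lt_succ_self t)]
  rw [hround]

open Classical in
theorem lintegral_mistake_add_potential_le [Fintype Y] (R : Representation X Y Φ m)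
    (hR : R.UniqueLabels) (env : Environment X Y) (ch : Choices X Y)
    {μ : Measure Ω} [IsProbabilityMeasure μ]
    (hB : ∀ t, Measurable (B t)) (hindep : iIndepFun B μ)
    (hp : ∀ t, μ {ω | B t ω = true} = ENNReal.ofReal (creationProb m)) (t : ℕ) :
    (∫⁻ ω, (if (roundAt m (m - 1) env ch (fun i => B i ω) t).IsMistake then 1 else 0) ∂μ) +
        ∫⁻ ω, (potential R env.y₀ (run m (m - 1) env ch (fun i => B i ω) (t + 1)).rules : ℝ≥0∞) ∂μ ≤
      (∫⁻ ω, (potential R env.y₀ (run m (m - 1) env ch (fun i => B i ω) t).rules : ℝ≥0∞) ∂μ) +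
        6 * ∫⁻ ω, (if (roundAt m (m - 1) env ch (fun i => B i ω) t).IsException R
          then 1 else 0) ∂μ := by
  have hpos : 0 < m := Nat.lt_of_le_of_lt (Nat.zero_le _) (R.comp env.x₀).isLt
  have hp0 := creationProb_nonneg hpos
  have hp1 := creationProb_le_one hpos
  have hF : ∀ b, ∀ c c' : ℕ → Bool, (∀ i < t, c i = c' i) →
      (potential R env.y₀ (step m (m - 1) env ch (run m (m - 1) env ch c t) b).rules : ℝ≥0∞) =
        potential R env.y₀ (step m (m - 1) env ch (run m (m - 1) env ch c' t) b).rules :=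
    fun b c c' h => by rw [run_congr m (m - 1) env ch h]
  have hnext := lintegral_next_bit hB hindep hp0 (hp t) hF
  have hV : Measurable fun ω =>
      (potential R env.y₀ (run m (m - 1) env ch (fun i => B i ω) t).rules : ℝ≥0∞) :=
    measurable_of_bits hB (t := t)
      (F := fun c => (potential R env.y₀ (run m (m - 1) env ch c t).rules : ℝ≥0∞))
      fun c c' h => by rw [run_congr m (m - 1) env ch h]
  have hM := measurable_indicator_round (m := m) hB (m - 1) env ch Round.IsMistake t
  have hE := measurable_indicator_round (m := m) hB (m - 1) env ch (Round.IsException R) t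
  have hS := fun b => measurable_of_bits hB (hF b)
  simp only [run]
  rw [hnext, ← lintegral_const_mul _ (hS true), ← lintegral_const_mul _ (hS false),
    ← lintegral_add_left ((hS true).const_mul _), ← lintegral_add_left hM,
    ← lintegral_const_mul _ hE, ← lintegral_add_left hV]
  refine lintegral_mono fun ω => ?_
  have h := ENNReal.ofReal_le_ofReal (mistake_add_potential_step_le R hR env ch
    (run m (m - 1) env ch (fun i => B i ω) t))
  rw [ENNReal.ofReal_add (by positivity)
      (mul_nonneg (sub_nonneg.2 hp1) (Nat.cast_nonneg _)),
    ENNReal.ofReal_add (Nat.cast_nonneg _) (by positivity),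
    ENNReal.ofReal_add (Nat.cast_nonneg _) (Nat.cast_nonneg _), ENNReal.ofReal_mul hp0,
    ENNReal.ofReal_mul (sub_nonneg.2 hp1)] at h
  simp only [ENNReal.ofReal_natCast] at h
  push_cast at h
  rw [← add_assoc]
  -- The bound for `playRound` with bit `true` applies to the actual round by definitional
  -- unfolding, as neither indicator reads the bit.
  exact h

open Classical in
theorem sum_lintegral_mistake_add_potential_le [Fintype Y] (R : Representation X Y Φ m)
    (hR : R.UniqueLabels) (env : Environment X Y) (ch : Choices X Y)
    {μ : Measure Ω} [IsProbabilityMeasure μ]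
    (hB : ∀ t, Measurable (B t)) (hindep : iIndepFun B μ)
    (hp : ∀ t, μ {ω | B t ω = true} = ENNReal.ofReal (creationProb m)) (T : ℕ) :
    (∑ t ∈ Finset.range T,
        ∫⁻ ω, (if (roundAt m (m - 1) env ch (fun i => B i ω) t).IsMistake then 1 else 0) ∂μ) +
        ∫⁻ ω, (potential R env.y₀ (run m (m - 1) env ch (fun i => B i ω) T).rules : ℝ≥0∞) ∂μ ≤
      potential R env.y₀ (fun _ => none) +
        6 * ∑ t ∈ Finset.range T,
          ∫⁻ ω, (if (roundAt m (m - 1) env ch (fun i => B i ω) t).IsException R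
            then 1 else 0) ∂μ := by
  induction T with
  | zero => simp [run]
  | succ T ih =>
    rw [Finset.sum_range_succ, Finset.sum_range_succ, mul_add, add_assoc]
    refine (add_le_add_right
      (lintegral_mistake_add_potential_le R hR env ch hB hindep hp T) _).trans ?_
    rw [← add_assoc, ← add_assoc (potential R env.y₀ _ : ℝ≥0∞)]
    exact add_le_add_left ih _

end Expectation

end DFF

/-! ### Passage to the total number of mistakes. -/

theorem mainTheorem5 {X Y Ω : Type*} [Finite Y]
    (Φ : Set (DFF.Feature X)) (hΦ : ∀ φ ∈ Φ, DFF.neg φ ∈ Φ)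
    (m k : ℕ) (R : DFF.Representation X Y Φ m) (hR : R.UniqueLabels)
    (env : DFF.Environment X Y) (ch : DFF.Choices X Y)
    [MeasurableSpace Ω] (μ : Measure Ω) [IsProbabilityMeasure μ]
    (B : ℕ → Ω → Bool) (hB : ∀ t, Measurable (B t)) (hindep : iIndepFun B μ)
    (hp : ∀ t, μ {ω | B t ω = true} =
      ENNReal.ofReal (if m = 1 then 1 else 1 / ((m : ℝ) - 1)))
    (hk : ∀ᵐ ω ∂μ, DFF.numExceptions R m (m - 1) env ch (fun t => B t ω) ≤ k) :
    ∫⁻ ω, DFF.numMistakes m (m - 1) env ch (fun t => B t ω) ∂μ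
      ≤ ENNReal.ofReal (2 * m * ((m : ℝ) - 1) + 6 * k) := by
  classical
  have := Fintype.ofFinite Y
  have hpos : 0 < m := Nat.lt_of_le_of_lt (Nat.zero_le _) (R.comp env.x₀).isLt
  have hM := DFF.measurable_indicator_round (m := m) hB (m - 1) env ch DFF.Round.IsMistake
  have hE := DFF.measurable_indicator_round (m := m) hB (m - 1) env ch (DFF.Round.IsException R)
  have hexc : (if env.y₀ ≠ R.target env.x₀ then 1 else 0 : ℝ≥0∞) +
      ∑' t, ∫⁻ ω, (if (DFF.roundAt m (m - 1) env ch (fun i => B i ω) t).IsException R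
        then 1 else 0) ∂μ ≤ k := by
    have h := lintegral_mono_ae hk
    simp only [DFF.numExceptions] at h
    rw [lintegral_add_left measurable_const, lintegral_tsum fun t => (hE t).aemeasurable] at h
    simpa using h
  have hinit : (DFF.potential R env.y₀ (fun _ => none) : ℝ≥0∞) ≤
      (2 * m * (m - 1) : ℕ) + 6 * (if env.y₀ ≠ R.target env.x₀ then 1 else 0 : ℝ≥0∞) := by
    have h := DFF.potential_empty_le R env.x₀ env.y₀
    exact_mod_cast h
  have hbound : ENNReal.ofReal (2 * m * ((m : ℝ) - 1) + 6 * k) =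
      ((2 * m * (m - 1) : ℕ) : ℝ≥0∞) + 6 * k := by
    have h : (2 * m * ((m : ℝ) - 1) + 6 * k) = ((2 * m * (m - 1) + 6 * k : ℕ) : ℝ) := by
      push_cast [hpos]
      ring
    rw [h, ENNReal.ofReal_natCast]
    push_cast
    rfl
  simp only [DFF.numMistakes]
  rw [lintegral_tsum fun t => (hM t).aemeasurable, hbound]
  refine ENNReal.tsum_le_of_sum_range_le fun T => ?_
  calc _ ≤ _ := le_self_add
    _ ≤ _ := DFF.sum_lintegral_mistake_add_potential_le R hR env ch hB hindep hp T
    _ ≤ ((2 * m * (m - 1) : ℕ) + 6 * (if env.y₀ ≠ R.target env.x₀ then 1 else 0 : ℝ≥0∞)) +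
        6 * ∑' t, ∫⁻ ω, (if (DFF.roundAt m (m - 1) env ch (fun i => B i ω) t).IsException R
          then 1 else 0) ∂μ := by
      gcongr
      exact ENNReal.sum_le_tsum _
    _ ≤ _ := by
      -- The initial exception and the later ones share the factor 6, and their expected number is
      -- at most `k` by `hexc`.
      rw [add_assoc, ← mul_add]
      gcongr
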